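/- Let $k\ge 4$ and let $n_1,\dots,n_k\ge 1$ be integers. Let $G=G_{n_1,\dots,n_k}$ be the graph whose vertex set is a disjoint union of $k$ parts of sizes $n_1,\dots,n_k$, two vertices being adjacent exactly when they lie in consecutive parts (parts $i$ and $i+1$ for some $1\le i\le k-1$). Let $L(G)=D-A$ be its Laplacian matrix, and let $K(G)$ be its critical group, i.e. the torsion subgroup of $\mathbb Z^{V}/\operatorname{im}L(G)$, for which $\mathbb Z^{V}/\operatorname{im}L(G)\cong\mathbb Z\oplus K(G)$. Put $N_1=n_2$, $N_k=n_{k-1}$ and $N_i=n_{i-1}+n_{i+1}$ for $2\le i\le k-1$. (a) If $n_i\ge 2$ for all $i$, then $$K(G)\;\cong\;\Big(\bigoplus_{i=1}^{k}(\mathbb Z/N_i\mathbb Z)^{\oplus (n_i-2)}\Big)\oplus \mathbb Z/\big(n_2(n_1+n_3)\big)\mathbb Z\oplus \mathbb Z/\big(n_{k-1}(n_{k-2}+n_k)\big)\mathbb Z\oplus\mathcal G ,$$ where $\mathcal G$ is a finite abelian group determined by $k$ and the numbers $n_1,\dots,n_k$. Consequently $\mathbb Z^V/\operatorname{im}L(G)\cong\mathbb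 Z\oplus K(G)$ is the direct sum of $\mathbb Z$ and the right-hand side. (b) For every ordering of the vertices, every row index $p$ and every column index $q$, the matrix $\overline{L(G)}$ obtained from $L(G)$ by striking out row $p$ and column $q$ satisfies $$(-1)^{p+q}\det\overline{L(G)}=\Big(\prod_{i=1}^{k}N_i^{\,n_i-1}\Big)\cdot\Big(\prod_{i=2}^{k-1}n_i\Big),$$ and this number is the number of spanning trees of $G$. -/

import Mathlib

/-- The cokernel `ℤ^V / im L(G)` of the Laplacian matrix of `G`. -/
abbrev SimpleGraph.LaplacianCokernel {V : Type*} [Fintype V] [DecidableEq V]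
    (G : SimpleGraph V) [DecidableRel G.Adj] : Type _ :=
  (V → ℤ) ⧸ LinearMap.range (Matrix.mulVecLin (G.lapMatrix ℤ))

/-- The critical group `K(G)`: the torsion subgroup of `ℤ^V / im L(G)`. For connected `G`
this is the group with `ℤ^V / im L(G) ≅ ℤ ⊕ K(G)`. -/
abbrev SimpleGraph.CriticalGroup {V : Type*} [Fintype V] [DecidableEq V]
    (G : SimpleGraph V) [DecidableRel G.Adj] : Type _ :=
  AddCommGroup.torsion G.LaplacianCokernel

/-- The number of spanning trees of `G`: trees on the full vertex set all of whose edges are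
edges of `G`. -/
noncomputable def SimpleGraph.numSpanningTrees {V : Type*} (G : SimpleGraph V) : ℕ :=
  Nat.card {T : SimpleGraph V // T ≤ G ∧ T.IsTree}

/-- The `k`-partite graph `G_{n_1,…,n_k}`. Its vertices are the pairs `⟨i, a⟩` with `i` the
(zero-based) index of the part and `a : Fin (n i)`; two vertices are adjacent exactly when
their parts are consecutive. -/
def chainGraph {k : ℕ} (n : Fin k → ℕ) : SimpleGraph (Σ i : Fin k, Fin (n i)) where
  Adj x y := (x.1 : ℕ) + 1 = (y.1 : ℕ) ∨ (y.1 : ℕ) + 1 = (x.1 : ℕ)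
  symm := ⟨fun _ _ h => h.symm⟩
  loopless := ⟨fun _ h => by omega⟩

instance chainGraph.instDecidableRelAdj {k : ℕ} (n : Fin k → ℕ) :
    DecidableRel (chainGraph n).Adj :=
  fun x y => inferInstanceAs
    (Decidable ((x.1 : ℕ) + 1 = (y.1 : ℕ) ∨ (y.1 : ℕ) + 1 = (x.1 : ℕ)))

/-- The numbers `N_i`: the sum of the sizes of the parts next to part `i`. In zero-based
indices this is `n 1` for `i = 0`, `n (k-2)` for `i = k-1`, and `n (i-1) + n (i+1)` otherwise
(for `k ≥ 2`). -/
def neighborSize {k : ℕ} (n : Fin k → ℕ) (i : Fin k) : ℕ :=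
  (if h : 0 < (i : ℕ) then n ⟨(i : ℕ) - 1, by omega⟩ else 0) +
  (if h : (i : ℕ) + 1 < k then n ⟨(i : ℕ) + 1, h⟩ else 0)

/-- The number `∏_{i=1}^{k} N_i^{n_i - 1} · ∏_{i=2}^{k-1} n_i`. -/
def chainTreeCount {k : ℕ} (n : Fin k → ℕ) : ℕ :=
  (∏ i : Fin k, neighborSize n i ^ (n i - 1)) *
    ∏ i ∈ Finset.univ.filter (fun i : Fin k => 0 < (i : ℕ) ∧ (i : ℕ) + 1 < k), n i

/-! Counting. The matrix-tree theorem makes every cofactor of the Laplacian `L` equal to the number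
τ of spanning trees. Adding the indicator of the first part to one row of that part turns the
determinant 0 into the sum of `n 0` cofactors, that is, `n 0` times τ. The new matrix is a diagonal
matrix minus a matrix whose entries depend on the column only through its part, so det(1 - XY) =
det(1 - YX) reduces it to a matrix of size k. This is a path Laplacian grounded at its first vertex,
and a factorisation through the incidence matrix evaluates it.

Decomposition. A harmonic function with values in ℤ/M is a character of the cokernel. Classes of
finite order that are dual to such characters split off as cyclic factors. Differences of two
vertices in one part have order dividing `N_i`, since the two vertices have the same neighbours. At
each end of the chain, the difference between a vertex of the end part and one of its neighbours
gives the remaining factor. The group `𝒢` is the common kernel of the characters on the torsion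
subgroup. -/

namespace SimpleGraph

/-! ### Spanning trees as parent functions -/

section ParentFunctions

variable {V : Type*}

/-- The graph whose edges join every vertex `v` to its parent `f v`. -/
def parentGraph (f : V → V) : SimpleGraph V where
  Adj u v := u ≠ v ∧ (f u = v ∨ f v = u)
  symm := ⟨fun _ _ h => ⟨h.1.symm, h.2.symm⟩⟩
  loopless := ⟨fun _ h => h.1 rfl⟩

/-- `f` assigns to every vertex a neighbour in `G` (and the root `r` to itself) such that
iterating `f` leads every vertex to the root. -/
structure IsParentFunction (G : SimpleGraph V) (r : V) (f : V → V) : Prop where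
  root : f r = r
  adj : ∀ v, v ≠ r → G.Adj v (f v)
  reach : ∀ v, ∃ m, f^[m] v = r

variable {G : SimpleGraph V} {r : V} {f g : V → V}

theorem IsParentFunction.parentGraph_le (h : G.IsParentFunction r f) : parentGraph f ≤ G := by
  have key : ∀ u v, u ≠ v → f u = v → G.Adj u v := by
    intro u v huv hf
    subst hf
    exact h.adj u fun hu => huv (by rw [hu, h.root])
  rintro u v ⟨huv, h1 | h1⟩
  · exact key u v huv h1
  · exact (key v u huv.symm h1).symm

theorem reachable_parentGraph_iterate (f : V → V) (m : ℕ) (v : V) :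
    (parentGraph f).Reachable v (f^[m] v) := by
  induction m generalizing v with
  | zero => exact Reachable.refl v
  | succ m ih =>
    refine Reachable.trans ?_ (ih (f v))
    by_cases hv : v = f v
    · rw [← hv]
    · exact Adj.reachable ⟨hv, Or.inl rfl⟩

theorem IsParentFunction.connected (h : G.IsParentFunction r f) : (parentGraph f).Connected := by
  have key : ∀ v, (parentGraph f).Reachable v r := fun v => by
    obtain ⟨m, hm⟩ := h.reach v
    simpa only [hm] using reachable_parentGraph_iterate f m v
  exact { preconnected := fun u v => (key u).trans (key v).symm, nonempty := ⟨r⟩ }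

/-- Every edge is `s(v, f v)` for some `v ≠ r`, so a connected graph on `V` has at most `|V| - 1`
edges here and must be a tree. -/
theorem IsParentFunction.isTree [Finite V] (h : G.IsParentFunction r f) :
    (parentGraph f).IsTree := by
  classical
  have := Fintype.ofFinite V
  rw [isTree_iff_connected_and_card]
  refine ⟨h.connected, le_antisymm ?_ h.connected.card_vert_le_card_edgeSet_add_one⟩
  have hsub : (parentGraph f).edgeSet ⊆
      ((Finset.univ.erase r).image fun v => s(v, f v) : Finset (Sym2 V)) := by
    intro e
    induction e using Sym2.ind with
    | _ u v =>
    have key : ∀ u v, u ≠ v → f u = v → s(u, v) ∈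
        (Finset.univ.erase r).image fun v => s(v, f v) := by
      rintro u _ huv rfl
      exact Finset.mem_image_of_mem _ (Finset.mem_erase.2
        ⟨fun hu => huv (by rw [hu, h.root]), Finset.mem_univ u⟩)
    rintro ⟨huv, h1 | h1⟩
    · exact key u v huv h1
    · rw [Sym2.eq_swap]
      exact key v u huv.symm h1
  have hcard := Set.ncard_le_ncard hsub (Finset.finite_toSet _)
  rw [Set.ncard_coe_finset] at hcard
  have h2 := hcard.trans Finset.card_image_le
  rw [Finset.card_erase_of_mem (Finset.mem_univ r), Finset.card_univ] at h2
  have h3 : 0 < Fintype.card V := Fintype.card_pos_iff.2 ⟨r⟩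
  rw [Nat.card_eq_fintype_card (α := V), Nat.card_coe_set_eq]
  omega

/-- Induction on the number of steps to the root. The edge from `v` to `f v` comes from `g` as well;
if it were `g (f v) = v`, the induction hypothesis would give `f (f v) = v`, a 2-cycle that never
reaches the root. -/
theorem IsParentFunction.eq_of_parentGraph_eq (hf : G.IsParentFunction r f)
    (hg : G.IsParentFunction r g) (h : parentGraph f = parentGraph g) : f = g := by
  have key : ∀ m v, f^[m] v = r → f v = g v := by
    intro m
    induction m with
    | zero =>
      intro v hv
      rw [show v = r from hv, hf.root, hg.root]
    | succ m ih =>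
      intro v hv
      by_cases hvr : v = r
      · rw [hvr, hf.root, hg.root]
      have hu := ih (f v) hv
      have hadj : (parentGraph g).Adj v (f v) := h ▸ ⟨(hf.adj v hvr).ne, Or.inl rfl⟩
      rcases hadj.2 with h1 | h1
      · exact h1.symm
      · exfalso
        rw [← hu] at h1
        obtain ⟨p, hp⟩ := hf.reach v
        have hcyc : ∀ p, f^[p] v = v ∨ f^[p] v = f v := by
          intro p
          induction p with
          | zero => exact Or.inl rfl
          | succ p ihp =>
            rw [Function.iterate_succ_apply']
            rcases ihp with h2 | h2 <;> rw [h2]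
            · exact Or.inr rfl
            · exact Or.inl h1
        rcases hcyc p with h2 | h2
        · exact hvr (h2.symm.trans hp)
        · rw [← h2, hp, hf.root] at h1
          exact hvr h1.symm
  funext v
  obtain ⟨m, hm⟩ := hf.reach v
  exact key m v hm

theorem Connected.exists_adj_dist_lt (hG : G.Connected) {v r : V} (hv : v ≠ r) :
    ∃ w, G.Adj v w ∧ G.dist w r < G.dist v r := by
  obtain ⟨p, hp⟩ := hG.exists_walk_length_eq_dist v r
  cases p with
  | nil => exact absurd rfl hv
  | cons hadj q =>
    refine ⟨_, hadj, ?_⟩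
    have := dist_le q
    rw [Walk.length_cons] at hp
    omega

/-- The parent of a vertex is a neighbour in `T` closer to `r`. The resulting connected subgraph is
all of `T` because a tree is minimal among connected graphs. -/
theorem IsTree.exists_isParentFunction {T : SimpleGraph V} (hT : T.IsTree) (hle : T ≤ G) (r : V) :
    ∃ f, G.IsParentFunction r f ∧ parentGraph f = T := by
  classical
  choose! p hadj hlt using fun v (hv : v ≠ r) => hT.connected.exists_adj_dist_lt hv
  let f : V → V := fun v => if v = r then r else p v
  have hroot : f r = r := if_pos rfl
  have hne : ∀ v, v ≠ r → f v = p v := fun v hv => if_neg hv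
  have hreach : ∀ d v, T.dist v r ≤ d → ∃ m, f^[m] v = r := by
    intro d
    induction d with
    | zero =>
      intro v hv
      by_cases hvr : v = r
      · exact ⟨0, hvr⟩
      · exact absurd (hlt v hvr) (by omega)
    | succ d ih =>
      intro v hv
      by_cases hvr : v = r
      · exact ⟨0, hvr⟩
      · have := hlt v hvr
        obtain ⟨m, hm⟩ := ih (f v) (by rw [hne v hvr]; omega)
        exact ⟨m + 1, hm⟩
  have hfT : T.IsParentFunction r f :=
    ⟨hroot, fun v hv => by rw [hne v hv]; exact hadj v hv, fun v => hreach _ v le_rfl⟩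
  refine ⟨f, ⟨hroot, fun v hv => hle (hfT.adj v hv), hfT.reach⟩, ?_⟩
  exact le_antisymm hfT.parentGraph_le
    ((isTree_iff_minimal_connected.1 hT).2 hfT.connected hfT.parentGraph_le)

/-- Choosing a root identifies spanning trees with parent functions. -/
theorem numSpanningTrees_eq_card_isParentFunction [Finite V] (G : SimpleGraph V) (r : V) :
    G.numSpanningTrees = Nat.card {f : V → V // G.IsParentFunction r f} := by
  refine (Nat.card_congr (Equiv.ofBijective
    (fun f : {f : V → V // G.IsParentFunction r f} =>
      (⟨parentGraph f.1, f.2.parentGraph_le, f.2.isTree⟩ :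
        {T : SimpleGraph V // T ≤ G ∧ T.IsTree})) ⟨?_, ?_⟩)).symm
  · intro f g h
    exact Subtype.ext (f.2.eq_of_parentGraph_eq g.2 (congrArg Subtype.val h))
  · rintro ⟨T, hle, hT⟩
    obtain ⟨f, hf, rfl⟩ := hT.exists_isParentFunction hle r
    exact ⟨⟨f, hf⟩, rfl⟩

end ParentFunctions

/-! ### The matrix-tree theorem for principal cofactors -/

section MatrixTree

open Matrix

variable {V : Type*} [Fintype V] [DecidableEq V]

/-- The matrix with row `e_v - e_{f v}` at every `v ≠ r`, and row `e_r` at the root. -/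
def parentMatrix (r : V) (f : V → V) : Matrix V V ℤ :=
  fun v => if v = r then Pi.single v 1 else Pi.single v 1 - Pi.single (f v) 1

theorem parentMatrix_mulVec (r : V) (f : V → V) (x : V → ℤ) (v : V) :
    (parentMatrix r f *ᵥ x) v = x v - if v = r then 0 else x (f v) := by
  rw [mulVec, parentMatrix]
  split_ifs
  · simp
  · change (Pi.single v 1 - Pi.single (f v) 1) ⬝ᵥ x = _
    simp [sub_dotProduct]

/-- The matrix is `1 - P`, where `P` moves along `f` and vanishes at the root. As all vertices reach
the root, `P` is nilpotent, and its characteristic polynomial, a power of X, is evaluated at 1. -/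
theorem det_parentMatrix_of_reach {r : V} {f : V → V} (h : ∀ v, ∃ m, f^[m] v = r) :
    (parentMatrix r f).det = 1 := by
  have hP : ∀ x v, ((1 - parentMatrix r f) *ᵥ x) v = if v = r then 0 else x (f v) := by
    intro x v
    rw [sub_mulVec, one_mulVec, Pi.sub_apply, parentMatrix_mulVec]
    ring
  have hpow : ∀ n v m, m < n → f^[m] v = r → ∀ x, ((1 - parentMatrix r f) ^ n *ᵥ x) v = 0 := by
    intro n
    induction n with
    | zero => intro v m hm; omega
    | succ n ih =>
      intro v m hm hv x
      rw [pow_succ', ← mulVec_mulVec, hP]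
      split_ifs with hvr
      · rfl
      · cases m with
        | zero => exact absurd hv hvr
        | succ m => exact ih (f v) m (by omega) hv x
  choose d hd using h
  have hnil : IsNilpotent (1 - parentMatrix r f) := by
    refine ⟨Finset.univ.sup d + 1, ?_⟩
    refine Matrix.ext_iff_mulVec.2 fun x => ?_
    ext v
    rw [hpow _ v (d v) (Nat.lt_succ_of_le (Finset.le_sup (Finset.mem_univ v))) (hd v), zero_mulVec,
      Pi.zero_apply]
  have hchar := (Matrix.isNilpotent_charpoly_sub_pow_of_isNilpotent hnil).eq_zero
  have heval := congrArg (Polynomial.eval 1) hchar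
  rw [Polynomial.eval_sub, Matrix.eval_charpoly] at heval
  simpa [sub_eq_zero] using heval

theorem det_parentMatrix_of_not_reach {r : V} {f : V → V} (h : ¬ ∀ v, ∃ m, f^[m] v = r) :
    (parentMatrix r f).det = 0 := by
  classical
  rw [← Matrix.exists_mulVec_eq_zero_iff]
  -- The indicator of the vertices that never reach `r` is invariant under `f` and zero at `r`,
  -- hence lies in the kernel.
  refine ⟨fun v => if ∃ m, f^[m] v = r then 0 else 1, ?_, ?_⟩
  · intro h0
    refine h fun v => by_contra fun hv => ?_
    have := congrFun h0 v
    simp [hv] at this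
  · ext v
    rw [parentMatrix_mulVec, Pi.zero_apply]
    by_cases hv : v = r
    · have h1 : ∃ m, f^[m] v = r := ⟨0, hv⟩
      rw [if_pos h1, if_pos hv, sub_zero]
    · have hiff : (∃ m, f^[m] v = r) ↔ ∃ m, f^[m] (f v) = r := by
        refine ⟨?_, fun ⟨m, hm⟩ => ⟨m + 1, hm⟩⟩
        rintro ⟨_ | m, hm⟩
        · exact absurd hm hv
        · exact ⟨m, hm⟩
      rw [if_neg hv, if_congr hiff rfl rfl, sub_self]

/-- The matrix-tree theorem, for the principal cofactors. -/
theorem adjugate_lapMatrix_diag (G : SimpleGraph V) [DecidableRel G.Adj] (r : V) :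
    (G.lapMatrix ℤ).adjugate r r = (G.numSpanningTrees : ℤ) := by
  classical
  let A : V → Finset V := fun v => if v = r then {r} else G.neighborFinset v
  let g : V → V → V → ℤ := fun v u =>
    if v = r then Pi.single v 1 else Pi.single v 1 - Pi.single u 1
  have hrow : (G.lapMatrix ℤ).updateRow r (Pi.single r 1) = fun v => ∑ u ∈ A v, g v u := by
    funext v
    by_cases hv : v = r
    · subst hv
      simp [A, g]
    · rw [updateRow_ne hv]
      simp only [A, g, if_neg hv]
      funext w
      rw [Finset.sum_apply]
      simp [lapMatrix, degMatrix, Pi.single_apply, diagonal_apply, adjMatrix_apply, eq_comm]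
  rw [adjugate_apply, hrow]
  -- Multilinearity in the rows gives one term for each choice of a neighbour at every `v ≠ r`; the
  -- row at `r` leaves no choice.
  have hexp := (Matrix.detRowAlternating (n := V) (R := ℤ)).toMultilinearMap.map_sum_finset g A
  change det _ = ∑ f ∈ Fintype.piFinset A, det _ at hexp
  rw [hexp]
  have hterm : ∀ f : V → V, (det fun v => g v (f v)) =
      if ∀ v, ∃ m, f^[m] v = r then 1 else 0 := by
    intro f
    split_ifs with h
    · exact det_parentMatrix_of_reach h
    · exact det_parentMatrix_of_not_reach h
  rw [Finset.sum_congr rfl fun f _ => hterm f, Finset.sum_boole,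
    numSpanningTrees_eq_card_isParentFunction G r, Nat.card_eq_fintype_card,
    Fintype.card_subtype]
  congr 2
  ext f
  simp only [Finset.mem_filter, Fintype.mem_piFinset, Finset.mem_univ, true_and, A]
  constructor
  · rintro ⟨h1, h2⟩
    refine ⟨by simpa using h1 r, fun v hv => by simpa [hv] using h1 v, h2⟩
  · intro h
    refine ⟨fun v => ?_, h.reach⟩
    split_ifs with hv
    · rw [hv, h.root]; exact Finset.mem_singleton_self r
    · rw [mem_neighborFinset]; exact h.adj v hv

end MatrixTree

end SimpleGraph

/-! ### All cofactors, and the degree and torsion of the cokernel -/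

namespace SimpleGraph

open Matrix

variable {V : Type*} [Fintype V] [DecidableEq V] (G : SimpleGraph V) [DecidableRel G.Adj]

variable {G} in
theorem Connected.eq_of_lapMatrix_mulVec_eq_zero (hG : G.Connected) {x : V → ℤ}
    (hx : G.lapMatrix ℤ *ᵥ x = 0) (u v : V) : x u = x v := by
  have h : G.lapMatrix ℝ *ᵥ (fun v => (x v : ℝ)) = 0 := by
    ext v
    have := congrFun hx v
    rw [lapMatrix_mulVec_apply, Pi.zero_apply] at this ⊢
    exact_mod_cast this
  exact_mod_cast (lapMatrix_mulVec_eq_zero_iff_forall_reachable G).1 h u v (hG.preconnected u v)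

theorem det_lapMatrix_int [Nonempty V] : (G.lapMatrix ℤ).det = 0 :=
  Matrix.exists_mulVec_eq_zero_iff.1
    ⟨fun _ => 1, fun h => one_ne_zero (congrFun h (Classical.arbitrary V)),
      lapMatrix_mulVec_const_eq_zero G⟩

variable {G} in
/-- The matrix-tree theorem: every cofactor of the Laplacian counts spanning trees. -/
theorem Connected.adjugate_lapMatrix (hG : G.Connected) (u v : V) :
    (G.lapMatrix ℤ).adjugate u v = (G.numSpanningTrees : ℤ) := by
  have := hG.nonempty
  rw [← adjugate_lapMatrix_diag G v]
  -- Since `L * adjugate L = 0`, each column of the adjugate lies in the kernel of `L` and is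
  -- constant.
  refine hG.eq_of_lapMatrix_mulVec_eq_zero (x := fun u => (G.lapMatrix ℤ).adjugate u v) ?_ u v
  have h := mul_adjugate (G.lapMatrix ℤ)
  rw [det_lapMatrix_int, zero_smul] at h
  ext w
  exact congrFun (congrFun h w) v

/-- The class of a vertex in the cokernel of the Laplacian. -/
def vertexClass (v : V) : G.LaplacianCokernel :=
  Submodule.Quotient.mk (Pi.single v 1)

theorem degree_nsmul_vertexClass (v : V) :
    G.degree v • G.vertexClass v = ∑ u ∈ G.neighborFinset v, G.vertexClass u := by
  have h : (Submodule.Quotient.mk (G.lapMatrix ℤ *ᵥ Pi.single v 1) : G.LaplacianCokernel) = 0 :=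
    (Submodule.Quotient.mk_eq_zero _).2 ⟨Pi.single v 1, rfl⟩
  have h2 : G.lapMatrix ℤ *ᵥ Pi.single v 1 =
      G.degree v • Pi.single v 1 - ∑ u ∈ G.neighborFinset v, Pi.single u 1 := by
    ext w
    rw [lapMatrix_mulVec_apply, Pi.sub_apply, Finset.sum_apply]
    by_cases hw : w = v
    · subst hw; simp [Pi.single_apply]
    · simp [Pi.single_apply, hw, eq_comm, G.adj_comm]
  rw [h2] at h
  have h3 := sub_eq_zero.1 ((map_sub (Submodule.mkQ _) _ _).symm.trans h)
  rwa [map_nsmul, map_sum] at h3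

variable {A : Type*} [AddCommGroup A]

/-- A harmonic function on the vertices induces a homomorphism on the cokernel. -/
def cokernelLift (φ : V → A)
    (hφ : ∀ v, G.degree v • φ v = ∑ u ∈ G.neighborFinset v, φ u) : G.LaplacianCokernel →+ A :=
  (Submodule.liftQ _ (Fintype.linearCombination ℤ φ) (by
    rw [LinearMap.range_le_ker_iff]
    refine LinearMap.pi_ext' fun v => LinearMap.ext_ring ?_
    have hcol : ∀ u, (G.lapMatrix ℤ *ᵥ Pi.single v 1) u =
        (if u = v then (G.degree v : ℤ) else 0) - if G.Adj v u then 1 else 0 := by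
      intro u
      by_cases hu : u = v
      · subst hu; simp [lapMatrix, degMatrix]
      · simp [lapMatrix, degMatrix, hu, adjMatrix_apply, G.adj_comm]
    simp only [LinearMap.comp_apply, LinearMap.single_apply, mulVecLin_apply, LinearMap.zero_apply,
      Fintype.linearCombination_apply, hcol, sub_smul, Finset.sum_sub_distrib, ite_smul, zero_smul,
      one_smul, Finset.sum_ite_eq', Finset.mem_univ, if_true, ← Finset.sum_filter, natCast_zsmul,
      hφ, neighborFinset_eq_filter, sub_self])).toAddMonoidHom

@[simp]
theorem cokernelLift_vertexClass (φ : V → A) (hφ) (v : V) :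
    G.cokernelLift φ hφ (G.vertexClass v) = φ v := by
  change Fintype.linearCombination ℤ φ (Pi.single v 1) = φ v
  simp

/-- The degree homomorphism on the cokernel. -/
def cokernelDegree : G.LaplacianCokernel →+ ℤ :=
  G.cokernelLift (fun _ => 1) (by simp)

theorem cokernelDegree_mk (x : V → ℤ) :
    G.cokernelDegree (Submodule.Quotient.mk x) = ∑ v, x v := by
  change Fintype.linearCombination ℤ (fun _ => (1 : ℤ)) x = _
  simp [Fintype.linearCombination_apply]

variable {G} in
theorem Connected.isOfFinAddOrder_of_cokernelDegree_eq_zero (hG : G.Connected)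
    {x : G.LaplacianCokernel} (hx : G.cokernelDegree x = 0) : IsOfFinAddOrder x := by
  have := hG.nonempty
  induction x using Submodule.Quotient.induction_on with
  | _ x =>
  rw [cokernelDegree_mk] at hx
  -- Adding the all-ones matrix makes `L` nonsingular without changing its action on vectors of sum
  -- zero.
  set M : Matrix V V ℤ := G.lapMatrix ℤ + of fun _ _ => 1 with hM
  have hJ : ∀ (w : V → ℤ) v, (M *ᵥ w) v = (G.lapMatrix ℤ *ᵥ w) v + ∑ u, w u := by
    intro w v
    rw [hM, add_mulVec, Pi.add_apply]
    congr 1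
    simp [mulVec, dotProduct]
  have hsumL : ∀ w : V → ℤ, ∑ v, (G.lapMatrix ℤ *ᵥ w) v = 0 := by
    intro w
    rw [← one_dotProduct, dotProduct_mulVec, ← mulVec_transpose,
      (isSymm_lapMatrix ℤ G).eq,
      show (1 : V → ℤ) = fun _ => 1 from rfl, lapMatrix_mulVec_const_eq_zero, zero_dotProduct]
  have hsum : ∀ w : V → ℤ, ∑ v, (M *ᵥ w) v = Fintype.card V * ∑ u, w u := by
    intro w
    simp only [hJ, Finset.sum_add_distrib, hsumL, zero_add, Finset.sum_const, Finset.card_univ,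
      nsmul_eq_mul]
  have hcard : (Fintype.card V : ℤ) ≠ 0 := Nat.cast_ne_zero.2 Fintype.card_ne_zero
  have hdet : M.det ≠ 0 := by
    intro h0
    obtain ⟨w, hw0, hw⟩ := Matrix.exists_mulVec_eq_zero_iff.2 h0
    have h1 := hsum w
    rw [hw] at h1
    have h2 : ∑ u, w u = 0 := by simpa [hcard] using h1
    have h3 : G.lapMatrix ℤ *ᵥ w = 0 := by
      ext v
      have := hJ w v
      rw [hw, h2] at this
      simpa using this.symm
    have h4 := hG.eq_of_lapMatrix_mulVec_eq_zero h3
    refine hw0 (funext fun v => ?_)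
    rw [Finset.sum_congr rfl fun u _ => h4 u v] at h2
    simpa using h2
  have hMw : M *ᵥ (M.adjugate *ᵥ x) = M.det • x := by
    rw [mulVec_mulVec, mul_adjugate, smul_mulVec, one_mulVec]
  have hw : ∑ u, (M.adjugate *ᵥ x) u = 0 := by
    have h1 := hsum (M.adjugate *ᵥ x)
    rw [hMw] at h1
    simp only [Pi.smul_apply, smul_eq_mul, ← Finset.mul_sum, hx, mul_zero] at h1
    simpa [hcard] using h1.symm
  rw [isOfFinAddOrder_iff_zsmul_eq_zero]
  refine ⟨M.det, hdet, ?_⟩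
  rw [← Submodule.Quotient.mk_smul, Submodule.Quotient.mk_eq_zero]
  refine ⟨M.adjugate *ᵥ x, ?_⟩
  rw [mulVecLin_apply, ← hMw]
  ext v
  rw [hJ, hw, add_zero]

variable {G} in
theorem Connected.ker_cokernelDegree (hG : G.Connected) :
    G.cokernelDegree.ker = AddCommGroup.torsion G.LaplacianCokernel := by
  ext x
  rw [AddMonoidHom.mem_ker]
  refine ⟨fun h => hG.isOfFinAddOrder_of_cokernelDegree_eq_zero h, fun h => ?_⟩
  obtain ⟨n, hn, h0⟩ := isOfFinAddOrder_iff_nsmul_eq_zero.1 (h : IsOfFinAddOrder x)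
  have h1 := congrArg G.cokernelDegree h0
  rw [map_nsmul, map_zero] at h1
  exact (smul_eq_zero.1 h1).resolve_left hn.ne'

instance : Finite G.CriticalGroup := by
  have h : AddGroup.FG G.CriticalGroup := by
    rw [AddGroup.fg_iff_addSubgroup_fg, ← AddSubgroup.toIntSubmodule_toAddSubgroup
      (AddCommGroup.torsion G.LaplacianCokernel), ← Submodule.fg_iff_addSubgroup_fg]
    exact IsNoetherian.noetherian _
  exact AddCommGroup.finite_of_fg_isAddTorsion _ fun x => by
    obtain ⟨n, hn, h0⟩ := isOfFinAddOrder_iff_nsmul_eq_zero.1 (x.2 : IsOfFinAddOrder x.1)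
    exact isOfFinAddOrder_iff_nsmul_eq_zero.2 ⟨n, hn, Subtype.ext h0⟩

end SimpleGraph

/-- A retraction splits off its target as a direct factor. -/
def AddMonoidHom.equivProdKerOfLeftInverse {A T : Type*} [AddCommGroup A] [AddCommGroup T]
    (g : A →+ T) (f : T →+ A) (h : Function.LeftInverse g f) : A ≃+ T × g.ker where
  toFun x := (g x, ⟨x - f (g x), by rw [AddMonoidHom.mem_ker, map_sub, h, sub_self]⟩)
  invFun y := f y.1 + y.2
  left_inv x := by simp
  right_inv y := by
    have h2 : g (y.2 : A) = 0 := y.2.2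
    ext <;> simp [h y.1, h2]
  map_add' x y := by
    ext
    · simp
    · simp only [map_add, Prod.snd_add, AddSubgroup.coe_add]
      abel

theorem SimpleGraph.Connected.nonempty_laplacianCokernel_equiv {V : Type*} [Fintype V]
    [DecidableEq V] {G : SimpleGraph V} [DecidableRel G.Adj] (hG : G.Connected) :
    Nonempty (G.LaplacianCokernel ≃+ ℤ × G.CriticalGroup) := by
  obtain ⟨r⟩ := hG.nonempty
  refine ⟨(G.cokernelDegree.equivProdKerOfLeftInverse
    (zmultiplesHom _ (G.vertexClass r)) fun n => ?_).trans
      ((AddEquiv.refl ℤ).prodCongr (AddEquiv.addSubgroupCongr hG.ker_cokernelDegree))⟩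
  simp [SimpleGraph.cokernelDegree]

/-! ### The grounded Laplacian of a weighted path -/

open Matrix

/-- The sum of the values of `F` at the neighbours of `i` in the path on `Fin k`. -/
def pathSum {k : ℕ} {M : Type*} [AddCommMonoid M] (F : Fin k → M) (i : Fin k) : M :=
  (if h : 0 < (i : ℕ) then F ⟨(i : ℕ) - 1, by omega⟩ else 0) +
  (if h : (i : ℕ) + 1 < k then F ⟨(i : ℕ) + 1, h⟩ else 0)

theorem sum_ite_path_eq_pathSum {k : ℕ} {M : Type*} [AddCommMonoid M] (F : Fin k → M)
    (i : Fin k) :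
    ∑ j : Fin k, (if (i : ℕ) + 1 = j ∨ (j : ℕ) + 1 = i then F j else 0) = pathSum F i := by
  have h : ∀ j : Fin k, (if (i : ℕ) + 1 = j ∨ (j : ℕ) + 1 = i then F j else 0) =
      (if (j : ℕ) + 1 = i then F j else 0) + if (i : ℕ) + 1 = j then F j else 0 := by
    intro j
    by_cases h1 : (j : ℕ) + 1 = i
    · rw [if_pos (Or.inr h1), if_pos h1, if_neg (by omega), add_zero]
    · simp [h1]
  rw [Finset.sum_congr rfl fun j _ => h j, Finset.sum_add_distrib, pathSum]
  congr 1
  · split_ifs with hi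
    · rw [Finset.sum_eq_single ⟨(i : ℕ) - 1, by omega⟩]
      · rw [if_pos (by simp only; omega)]
      · intro j _ hj
        exact if_neg fun h => hj (Fin.ext (by simp only; omega))
      · simp
    · exact Finset.sum_eq_zero fun j _ => if_neg (by omega)
  · split_ifs with hi
    · rw [Finset.sum_eq_single ⟨(i : ℕ) + 1, hi⟩]
      · rw [if_pos rfl]
      · intro j _ hj
        exact if_neg fun h => hj (Fin.ext h.symm)
      · simp
    · exact Finset.sum_eq_zero fun j _ => if_neg (by omega)

section PathLaplacian

variable {R : Type*} [CommRing R] {K : ℕ}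

/-- The weighted Laplacian of the path, grounded at the first vertex. -/
def groundedPathMatrix (n : Fin (K + 1) → R) : Matrix (Fin (K + 1)) (Fin (K + 1)) R :=
  of fun i j => (if i = j then pathSum n i else 0) -
    n i * (if (i : ℕ) + 1 = j ∨ (j : ℕ) + 1 = i then 1 else 0) +
    if i = 0 ∧ j = 0 then 1 else 0

theorem groundedPathMatrix_mul_diagonal_mulVec (n x : Fin (K + 1) → R) (i : Fin (K + 1)) :
    ((groundedPathMatrix n * diagonal n) *ᵥ x) i =
      n i * (pathSum n i * x i - pathSum (fun j => n j * x j) i + if i = 0 then x i else 0) := by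
  rw [← mulVec_mulVec, mulVec, dotProduct, ← sum_ite_path_eq_pathSum (fun j => n j * x j)]
  simp only [groundedPathMatrix, of_apply, mulVec_diagonal, add_mul, sub_mul,
    Finset.sum_add_distrib, Finset.sum_sub_distrib, ite_mul, zero_mul, one_mul,
    Finset.sum_ite_eq, Finset.mem_univ, if_true, mul_add, mul_sub, Finset.mul_sum, ite_and,
    mul_ite, mul_one, mul_zero]
  congr 1
  · congr 1
    ring
  · split_ifs with h
    · subst h; simp
    · simp

/-- The oriented incidence matrix of the path, with the first vertex joined to a root. -/
def pathIncidence (R : Type*) [CommRing R] (K : ℕ) : Matrix (Fin (K + 1)) (Fin (K + 1)) R :=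
  of fun i j => (if i = j then 1 else 0) - if (i : ℕ) + 1 = j then 1 else 0

theorem det_pathIncidence : (pathIncidence R K).det = 1 := by
  rw [det_of_isUpperTriangular]
  · exact Finset.prod_eq_one fun i _ => by simp [pathIncidence]
  · intro i j hij
    have h : (j : ℕ) < i := hij
    have h1 : i ≠ j := fun h1 => by subst h1; omega
    simp [pathIncidence, h1, show ¬ (i : ℕ) + 1 = j by omega]

theorem pathIncidence_mulVec (y : Fin (K + 1) → R) (i : Fin (K + 1)) :
    (pathIncidence R K *ᵥ y) i =
      y i - if h : (i : ℕ) + 1 < K + 1 then y ⟨(i : ℕ) + 1, h⟩ else 0 := by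
  simp only [mulVec, dotProduct, pathIncidence, of_apply, sub_mul, Finset.sum_sub_distrib,
    ite_mul, zero_mul, one_mul, Finset.sum_ite_eq, Finset.mem_univ, if_true]
  congr 1
  split_ifs with hi
  · rw [Finset.sum_eq_single ⟨(i : ℕ) + 1, hi⟩]
    · rw [if_pos rfl]
    · intro j _ hj
      exact if_neg fun h => hj (Fin.ext h.symm)
    · simp
  · exact Finset.sum_eq_zero fun j _ => if_neg (by omega)

theorem pathIncidence_transpose_mulVec (y : Fin (K + 1) → R) (i : Fin (K + 1)) :
    ((pathIncidence R K)ᵀ *ᵥ y) i =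
      y i - if h : 0 < (i : ℕ) then y ⟨(i : ℕ) - 1, by omega⟩ else 0 := by
  simp only [mulVec, dotProduct, pathIncidence, transpose_apply, of_apply, sub_mul,
    Finset.sum_sub_distrib, ite_mul, zero_mul, one_mul, Finset.sum_ite_eq', Finset.mem_univ,
    if_true]
  congr 1
  split_ifs with hi
  · rw [Finset.sum_eq_single ⟨(i : ℕ) - 1, by omega⟩]
    · rw [if_pos (by simp only; omega)]
    · intro j _ hj
      exact if_neg fun h => hj (Fin.ext (by simp only; omega))
    · simp
  · exact Finset.sum_eq_zero fun j _ => if_neg (by omega)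

/-- Scaling the columns symmetrises the matrix: the edge between consecutive vertices gets the
product of their weights. The default value 1 is the weight of the root joined to the first vertex.
-/
theorem groundedPathMatrix_mul_diagonal (n : Fin (K + 1) → R) :
    groundedPathMatrix n * diagonal n = pathIncidence R K *
      diagonal (fun i => n i * if h : 0 < (i : ℕ) then n ⟨(i : ℕ) - 1, by omega⟩ else 1) *
      (pathIncidence R K)ᵀ := by
  refine Matrix.ext_iff_mulVec.2 fun x => ?_
  ext i
  rw [groundedPathMatrix_mul_diagonal_mulVec, ← mulVec_mulVec, ← mulVec_mulVec,
    pathIncidence_mulVec]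
  simp only [mulVec_diagonal, pathIncidence_transpose_mulVec, pathSum]
  by_cases h0 : 0 < (i : ℕ) <;> by_cases h1 : (i : ℕ) + 1 < K + 1
  · have : i ≠ 0 := fun h => by simp [h] at h0
    simp [h0, this, show (i : ℕ) < K by omega]
    ring
  · have : i ≠ 0 := fun h => by simp [h] at h0
    simp [h0, this, show ¬ (i : ℕ) < K by omega]
    ring
  · have : i = 0 := Fin.ext (by simp only [Fin.val_zero]; omega)
    subst this
    simp [show 0 < K by simpa using h1]
    ring
  · have : i = 0 := Fin.ext (by simp only [Fin.val_zero]; omega)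
    subst this
    simp [show ¬ 0 < K by simpa using h1]

theorem det_groundedPathMatrix [IsDomain R] (n : Fin (K + 1) → R) (hn : ∀ i, n i ≠ 0) :
    (groundedPathMatrix n).det = ∏ i : Fin K, n i.castSucc := by
  have h := congrArg det (groundedPathMatrix_mul_diagonal n)
  rw [det_mul, det_mul, det_mul, det_transpose, det_pathIncidence, det_diagonal, det_diagonal,
    Finset.prod_mul_distrib, one_mul, mul_one, mul_comm] at h
  rw [mul_left_cancel₀ (Finset.prod_ne_zero_iff.2 fun i _ => hn i) h, Fin.prod_univ_succ]
  simp
  rfl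

end PathLaplacian

/-! ### The number of spanning trees of the chain graph -/

section ChainGraph

theorem neighborSize_eq_pathSum {k : ℕ} (n : Fin k → ℕ) (i : Fin k) :
    neighborSize n i = pathSum n i := rfl

theorem sum_neighborFinset_chainGraph {k : ℕ} (n : Fin k → ℕ) {M : Type*} [AddCommMonoid M]
    (φ : (Σ i : Fin k, Fin (n i)) → M) (v : Σ i : Fin k, Fin (n i)) :
    ∑ u ∈ (chainGraph n).neighborFinset v, φ u = pathSum (fun i => ∑ a, φ ⟨i, a⟩) v.1 := by
  rw [SimpleGraph.neighborFinset_eq_filter, Finset.sum_filter, Fintype.sum_sigma,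
    ← sum_ite_path_eq_pathSum]
  refine Finset.sum_congr rfl fun i _ => ?_
  by_cases h : (v.1 : ℕ) + 1 = i ∨ (i : ℕ) + 1 = v.1
  · rw [if_pos h]
    exact Finset.sum_congr rfl fun a _ => if_pos h
  · rw [if_neg h]
    exact Finset.sum_eq_zero fun a _ => if_neg h

theorem degree_chainGraph {k : ℕ} (n : Fin k → ℕ) (v : Σ i : Fin k, Fin (n i)) :
    (chainGraph n).degree v = neighborSize n v.1 := by
  rw [← SimpleGraph.card_neighborFinset_eq_degree, Finset.card_eq_sum_ones,
    sum_neighborFinset_chainGraph, neighborSize_eq_pathSum]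
  simp

theorem connected_chainGraph {k : ℕ} (hk : 2 ≤ k) (n : Fin k → ℕ) (hn : ∀ i, 1 ≤ n i) :
    (chainGraph n).Connected := by
  have hreach : ∀ (d : ℕ) (hd : d < k) (a : Fin (n ⟨d, hd⟩)),
      (chainGraph n).Reachable ⟨⟨d, hd⟩, a⟩ ⟨⟨0, by omega⟩, ⟨0, hn _⟩⟩ := by
    have hstep : ∀ (d : ℕ) (hd : d < k) (hd' : d + 1 < k) (a : Fin (n ⟨d, hd⟩))
        (b : Fin (n ⟨d + 1, hd'⟩)),
        (chainGraph n).Reachable ⟨⟨d + 1, hd'⟩, b⟩ ⟨⟨d, hd⟩, a⟩ := fun d hd hd' a b =>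
      SimpleGraph.Adj.reachable (Or.inr rfl)
    intro d
    induction d with
    | zero =>
      intro hd a
      exact (hstep 0 hd (by omega) a ⟨0, hn _⟩).symm.trans (hstep 0 hd (by omega) _ _)
    | succ d ih =>
      intro hd a
      exact (hstep d (by omega) hd ⟨0, hn _⟩ a).trans (ih _ _)
  exact { preconnected := fun u v => (hreach u.1 u.1.2 u.2).trans (hreach v.1 v.1.2 v.2).symm
          nonempty := ⟨⟨⟨0, by omega⟩, ⟨0, hn _⟩⟩⟩ }

theorem neighborSize_pos {k : ℕ} (hk : 2 ≤ k) (n : Fin k → ℕ) (hn : ∀ i, 1 ≤ n i) (i : Fin k) :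
    0 < neighborSize n i := by
  unfold neighborSize
  by_cases h : 0 < (i : ℕ)
  · rw [dif_pos h]
    exact Nat.add_pos_left (hn _) _
  · rw [dif_neg h, dif_pos (by omega)]
    exact Nat.add_pos_right _ (hn _)

/-- The determinant of a matrix that is constant on the blocks of a partition, up to a diagonal
matrix that is constant on the parts. -/
theorem det_diagonal_sub_blocks {k : ℕ} (n : Fin k → ℕ) (hn : ∀ i, 1 ≤ n i) (N : Fin k → ℚ)
    (hN : ∀ i, N i ≠ 0) (U : Matrix (Σ i : Fin k, Fin (n i)) (Fin k) ℚ) :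
    (of fun v u : Σ i : Fin k, Fin (n i) => (if v = u then N v.1 else 0) - U v u.1).det =
      (∏ i, N i ^ (n i - 1)) *
        (of fun i j => (if i = j then N i else 0) - ∑ a, U ⟨i, a⟩ j).det := by
  set D : Matrix (Σ i : Fin k, Fin (n i)) (Σ i : Fin k, Fin (n i)) ℚ := diagonal fun v => N v.1
  set D' : Matrix (Σ i : Fin k, Fin (n i)) (Σ i : Fin k, Fin (n i)) ℚ :=
    diagonal fun v => (N v.1)⁻¹
  set P : Matrix (Fin k) (Σ i : Fin k, Fin (n i)) ℚ := of fun j u => if u.1 = j then 1 else 0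
  have h1 : (of fun v u : Σ i : Fin k, Fin (n i) => (if v = u then N v.1 else 0) - U v u.1) =
      D * (1 - D' * U * P) := by
    have hDD : D * D' = 1 := by
      rw [diagonal_mul_diagonal, ← diagonal_one]
      exact congrArg diagonal (funext fun v => mul_inv_cancel₀ (hN v.1))
    rw [Matrix.mul_sub, Matrix.mul_one, Matrix.mul_assoc D' U P, ← Matrix.mul_assoc D, hDD,
      Matrix.one_mul]
    ext v u
    simp [D, P, diagonal_apply, mul_apply]
  have h2 : (of fun i j => (if i = j then N i else 0) - ∑ a, U ⟨i, a⟩ j) =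
      diagonal N * (1 - P * (D' * U)) := by
    ext i j
    rw [diagonal_mul, Matrix.sub_apply, mul_apply, Fintype.sum_sigma, Finset.sum_eq_single i]
    · simp only [P, D', of_apply, if_true, one_mul, diagonal_mul, ← Finset.mul_sum, mul_sub,
        one_apply, mul_ite, mul_one, mul_zero, mul_inv_cancel_left₀ (hN i)]
    · intro i' _ hi'
      exact Finset.sum_eq_zero fun a _ => by simp [P, hi']
    · simp
  have h3 : D.det = (∏ i, N i ^ (n i - 1)) * ∏ i, N i := by
    rw [det_diagonal, Fintype.prod_sigma, ← Finset.prod_mul_distrib]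
    refine Finset.prod_congr rfl fun i _ => ?_
    rw [← pow_succ, Nat.sub_add_cancel (hn i)]
    simp
  -- The exchange det(1 - XY) = det(1 - YX) passes from vertices to parts.
  rw [h1, h2, det_mul, det_mul, det_one_sub_mul_comm, h3, det_diagonal, mul_assoc]

theorem det_lapMatrix_chainGraph_updateRow {K : ℕ} (n : Fin (K + 1) → ℕ) (hK : 1 ≤ K)
    (hn : ∀ i, 1 ≤ n i) (a : Fin (n 0)) :
    (((chainGraph n).lapMatrix ℤ).updateRow ⟨0, a⟩
      ((chainGraph n).lapMatrix ℤ ⟨0, a⟩ + fun u => if u.1 = 0 then 1 else 0)).det =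
      ((∏ i, neighborSize n i ^ (n i - 1)) * ∏ i : Fin K, n i.castSucc : ℕ) := by
  have hN : ∀ i, (neighborSize n i : ℚ) ≠ 0 := fun i =>
    Nat.cast_ne_zero.2 (neighborSize_pos (by omega) n hn i).ne'
  have hcast : ∀ i, (neighborSize n i : ℚ) = pathSum (fun j => (n j : ℚ)) i := by
    intro i
    rw [neighborSize, pathSum]
    push_cast
    congr 1 <;> split_ifs <;> simp
  have hdet := det_diagonal_sub_blocks n hn (fun i => (neighborSize n i : ℚ)) hN
    (of fun v j => (if (v.1 : ℕ) + 1 = j ∨ (j : ℕ) + 1 = v.1 then 1 else 0) -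
      if v = ⟨0, a⟩ ∧ j = 0 then 1 else 0)
  have hQ : (of fun i j : Fin (K + 1) => (if i = j then (neighborSize n i : ℚ) else 0) -
      ∑ b, (of fun (v : Σ i : Fin (K + 1), Fin (n i)) (j : Fin (K + 1)) =>
        (if (v.1 : ℕ) + 1 = j ∨ (j : ℕ) + 1 = v.1 then (1 : ℚ) else 0) -
          if v = ⟨0, a⟩ ∧ j = 0 then 1 else 0) ⟨i, b⟩ j) =
      groundedPathMatrix fun i => (n i : ℚ) := by
    ext i j
    simp only [groundedPathMatrix, of_apply, Finset.sum_sub_distrib, hcast, sub_sub_eq_add_sub]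
    rw [sub_add_eq_add_sub]
    congr 2
    by_cases hi : i = 0
    · subst hi
      simp [ite_and]
    · simp [hi]
    · split_ifs <;> simp
  rw [hQ, det_groundedPathMatrix _ fun i => Nat.cast_ne_zero.2 (Nat.one_le_iff_ne_zero.1 (hn i))]
    at hdet
  apply Int.cast_injective (α := ℚ)
  push_cast
  rw [← hdet]
  congr 1
  ext v u
  have hL : (chainGraph n).lapMatrix ℤ v u = (if v = u then (neighborSize n v.1 : ℤ) else 0) -
      if (v.1 : ℕ) + 1 = u.1 ∨ (u.1 : ℕ) + 1 = v.1 then 1 else 0 := by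
    rw [SimpleGraph.lapMatrix, SimpleGraph.degMatrix, Matrix.sub_apply, diagonal_apply,
      SimpleGraph.adjMatrix_apply, degree_chainGraph]
    rfl
  simp only [map_apply, of_apply]
  by_cases hv : v = ⟨0, a⟩
  · subst hv
    rw [updateRow_self, Pi.add_apply, hL]
    push_cast
    simp only [true_and]
    ring
  · rw [updateRow_ne hv, hL]
    push_cast
    simp [hv]

theorem numSpanningTrees_chainGraph {k : ℕ} (hk : 2 ≤ k) (n : Fin k → ℕ) (hn : ∀ i, 1 ≤ n i) :
    (chainGraph n).numSpanningTrees = chainTreeCount n := by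
  obtain ⟨K, rfl⟩ : ∃ K, k = K + 1 + 1 := ⟨k - 2, by omega⟩
  have hconn := connected_chainGraph hk n hn
  have := hconn.nonempty
  have h := det_lapMatrix_chainGraph_updateRow n (by omega) hn ⟨0, hn 0⟩
  -- Linearity in the modified row leaves the sum of its cofactors over the first part, each equal
  -- to the number of spanning trees.
  rw [det_updateRow_add, updateRow_eq_self, SimpleGraph.det_lapMatrix_int, zero_add,
    ← cramer_transpose_apply, cramer_eq_adjugate_mulVec, ← adjugate_transpose, mulVec,
    dotProduct] at h
  simp only [transpose_apply, hconn.adjugate_lapMatrix, ← Finset.mul_sum,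
    Fintype.sum_sigma] at h
  rw [Finset.sum_eq_single 0 (fun i _ hi => Finset.sum_eq_zero fun a _ => if_neg hi) (by simp)] at h
  simp only [if_true, Finset.sum_const, Finset.card_univ, Fintype.card_fin, nsmul_eq_mul,
    mul_one] at h
  have h2 : (chainGraph n).numSpanningTrees * n 0 = chainTreeCount n * n 0 := by
    rw [chainTreeCount, mul_assoc]
    have h3 : (∏ i ∈ Finset.univ.filter
        (fun i : Fin (K + 1 + 1) => 0 < (i : ℕ) ∧ (i : ℕ) + 1 < K + 1 + 1), n i) * n 0 =
        ∏ i : Fin (K + 1), n i.castSucc := by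
      rw [Finset.prod_filter, Fin.prod_univ_castSucc, Fin.prod_univ_succ,
        Fin.prod_univ_succ (fun i : Fin (K + 1) => n i.castSucc)]
      simp [mul_comm]
    rw [h3]
    exact_mod_cast h
  exact Nat.eq_of_mul_eq_mul_right (hn 0) h2

end ChainGraph

/-- Elements of finite order that are dual to a family of characters span a direct factor. -/
theorem nonempty_equiv_pi_zmod_prod_ker {A ι : Type*} [AddCommGroup A] [Fintype ι] [DecidableEq ι]
    (M : ι → ℕ) (x : ι → A) (hx : ∀ j, M j • x j = 0) (χ : ∀ j, A →+ ZMod (M j))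
    (hχ : ∀ i j, χ i (x j) = if i = j then 1 else 0) :
    Nonempty (A ≃+ ((j : ι) → ZMod (M j)) × (AddMonoidHom.pi χ).ker) := by
  let f : ((j : ι) → ZMod (M j)) →+ A := ∑ j, (ZMod.lift (M j) ⟨zmultiplesHom A (x j), by
    simpa using hx j⟩).comp (Pi.evalAddMonoidHom _ j)
  refine ⟨(AddMonoidHom.pi χ).equivProdKerOfLeftInverse f fun s => ?_⟩
  funext i
  choose z hz using fun j => ZMod.intCast_surjective (s j)
  have hf : f s = ∑ j, z j • x j := by
    simp only [f, AddMonoidHom.finsetSum_apply, AddMonoidHom.comp_apply,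
      Pi.evalAddMonoidHom_apply]
    refine Finset.sum_congr rfl fun j _ => ?_
    rw [← hz j, ZMod.lift_coe]
    rfl
  change χ i (f s) = s i
  rw [hf, map_sum]
  simp only [map_zsmul, hχ, smul_ite, smul_zero, Finset.sum_ite_eq, Finset.mem_univ, if_true]
  simpa using hz i

/-! ### Cyclic factors from dual classes and characters -/

section Decomposition

variable {k : ℕ} (n : Fin k → ℕ)

theorem sum_neighborFinset_chainGraph_ite {M : Type*} [AddCommMonoid M]
    (φ : (Σ i : Fin k, Fin (n i)) → M) (v : Σ i : Fin k, Fin (n i)) :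
    ∑ u ∈ (chainGraph n).neighborFinset v, φ u =
      ∑ i : Fin k, if (v.1 : ℕ) + 1 = i ∨ (i : ℕ) + 1 = v.1 then ∑ a, φ ⟨i, a⟩ else 0 := by
  rw [sum_neighborFinset_chainGraph, ← sum_ite_path_eq_pathSum]

theorem neighborSize_nsmul_vertexClass (i : Fin k) (a b : Fin (n i)) :
    neighborSize n i • (chainGraph n).vertexClass ⟨i, a⟩ =
      neighborSize n i • (chainGraph n).vertexClass ⟨i, b⟩ := by
  rw [← degree_chainGraph n ⟨i, a⟩, SimpleGraph.degree_nsmul_vertexClass,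
    sum_neighborFinset_chainGraph, degree_chainGraph n ⟨i, a⟩, ← degree_chainGraph n ⟨i, b⟩,
    SimpleGraph.degree_nsmul_vertexClass, sum_neighborFinset_chainGraph]

/-- The harmonic function `±1` on two vertices of part `i`, the second one being `⟨i, 1⟩`. -/
def twinCharacter (i : Fin k) (b : ℕ) (v : Σ i : Fin k, Fin (n i)) : ZMod (neighborSize n i) :=
  if v.1 = i then (if (v.2 : ℕ) = b + 2 then 1 else 0) - (if (v.2 : ℕ) = 1 then 1 else 0) else 0

theorem sum_fin_ite_val_eq {R : Type*} [AddCommMonoid R] {m c : ℕ} (hc : c < m) (x : R) :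
    ∑ a : Fin m, (if (a : ℕ) = c then x else 0) = x := by
  rw [Finset.sum_eq_single ⟨c, hc⟩ (fun a _ ha => if_neg fun h => ha (Fin.ext h)) (by simp)]
  exact if_pos rfl

/-- The sum over each part is zero, and the degree on part `i` is `N_i`, which vanishes in the
target. -/
theorem twinCharacter_harmonic (i : Fin k) (b : ℕ) (hb : b + 2 < n i)
    (v : Σ i : Fin k, Fin (n i)) :
    (chainGraph n).degree v • twinCharacter n i b v =
      ∑ u ∈ (chainGraph n).neighborFinset v, twinCharacter n i b u := by
  rw [sum_neighborFinset_chainGraph_ite, Finset.sum_eq_zero, degree_chainGraph]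
  · by_cases h : v.1 = i
    · rw [h, nsmul_eq_mul, ZMod.natCast_self, zero_mul]
    · rw [twinCharacter, if_neg h, smul_zero]
  · intro j _
    refine ite_eq_right_iff.2 fun _ => ?_
    by_cases h : j = i
    · subst h
      simp only [twinCharacter, if_true, Finset.sum_sub_distrib]
      rw [sum_fin_ite_val_eq hb, sum_fin_ite_val_eq (by omega), sub_self]
    · exact Finset.sum_eq_zero fun a _ => if_neg h

/-- The harmonic function attached to an end `i` of the chain and its only neighbour `j`. -/
def endCharacter (i j : Fin k) (v : Σ i : Fin k, Fin (n i)) : ZMod (n j * neighborSize n j) :=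
  if v.1 = i then (if (v.2 : ℕ) = 1 then (neighborSize n j : ZMod _) else 0)
  else if v.1 = j then 1 - (if (v.2 : ℕ) = 1 then (n j : ZMod _) else 0) else 0

/-- The values on part `j` sum to zero and those on part `i` to `N_j`. This sum is what the vertices
of `j` need; on part `i` the degree `n j` kills the value `N_j`. -/
theorem endCharacter_harmonic (i j : Fin k) (hi : 2 ≤ n i) (hj : 2 ≤ n j)
    (hij : ∀ l : Fin k, ((l : ℕ) + 1 = i ∨ (i : ℕ) + 1 = l) ↔ l = j)
    (v : Σ i : Fin k, Fin (n i)) :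
    (chainGraph n).degree v • endCharacter n i j v =
      ∑ u ∈ (chainGraph n).neighborFinset v, endCharacter n i j u := by
  have hne : j ≠ i := by
    rintro rfl
    have := (hij j).2 rfl
    omega
  have h0 : (n j : ZMod (n j * neighborSize n j)) * neighborSize n j = 0 := by
    rw [← Nat.cast_mul, ZMod.natCast_self]
  have hNi : neighborSize n i = n j := by
    rw [neighborSize_eq_pathSum, ← sum_ite_path_eq_pathSum]
    simp [fun l => or_comm.trans (hij l)]
  have hS : ∀ l, ∑ a, endCharacter n i j ⟨l, a⟩ =
      if l = i then (neighborSize n j : ZMod _) else 0 := by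
    intro l
    by_cases hl : l = i
    · subst hl
      simp only [endCharacter, if_true]
      exact sum_fin_ite_val_eq hi _
    · by_cases hl' : l = j
      · subst hl'
        simp only [endCharacter, if_neg hl, if_true, Finset.sum_sub_distrib]
        rw [sum_fin_ite_val_eq hj]
        simp
      · simp [endCharacter, hl, hl']
  rw [sum_neighborFinset_chainGraph_ite, degree_chainGraph]
  simp only [hS]
  rw [Finset.sum_eq_single i (fun l _ hl => by rw [if_neg hl, ite_self]) (by simp), if_pos rfl,
    if_congr (hij v.1) rfl rfl, nsmul_eq_mul]
  by_cases hv : v.1 = i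
  · have hvj : ¬ v.1 = j := fun h => hne (h.symm.trans hv)
    rw [endCharacter, if_pos hv, if_neg hvj, show neighborSize n v.1 = n j by rw [hv, hNi]]
    split_ifs
    · exact h0
    · exact mul_zero _
  · by_cases hv' : v.1 = j
    · rw [endCharacter, if_neg hv, if_pos hv', if_pos hv',
        show neighborSize n v.1 = neighborSize n j by rw [hv']]
      split_ifs
      · linear_combination (-1) * h0
      · rw [sub_zero, mul_one]
    · rw [endCharacter, if_neg hv, if_neg hv', if_neg hv', mul_zero]

/-- The relation at an end vertex says that `n j` times its class is the sum of the classes in part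
`j`; these all agree after multiplication by `N_j`. -/
theorem nsmul_endClass_eq_zero (i j : Fin k)
    (hij : ∀ l : Fin k, ((l : ℕ) + 1 = i ∨ (i : ℕ) + 1 = l) ↔ l = j) (a : Fin (n i))
    (b : Fin (n j)) :
    (n j * neighborSize n j) •
      ((chainGraph n).vertexClass ⟨j, b⟩ - (chainGraph n).vertexClass ⟨i, a⟩) = 0 := by
  have hNi : neighborSize n i = n j := by
    rw [neighborSize_eq_pathSum, ← sum_ite_path_eq_pathSum]
    simp [fun l => or_comm.trans (hij l)]
  have h1 : n j • (chainGraph n).vertexClass ⟨i, a⟩ =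
      ∑ c, (chainGraph n).vertexClass ⟨j, c⟩ := by
    have h := (chainGraph n).degree_nsmul_vertexClass ⟨i, a⟩
    rw [degree_chainGraph, hNi, sum_neighborFinset_chainGraph_ite] at h
    rw [h]
    simp [fun l => or_comm.trans (hij l)]
  have h2 : n j • neighborSize n j • (chainGraph n).vertexClass ⟨j, b⟩ =
      neighborSize n j • ∑ c, (chainGraph n).vertexClass ⟨j, c⟩ := by
    rw [Finset.smul_sum, Finset.sum_congr rfl fun c _ => neighborSize_nsmul_vertexClass n j c b]
    simp
  rw [smul_sub, mul_smul, h2, mul_comm, mul_smul, h1, sub_self]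

/-- The cyclic factors of the critical group: `n i - 2` of them for part `i`, and one for each
end of the chain. -/
abbrev ChainIndex : Type := (Σ i : Fin k, Fin (n i - 2)) ⊕ Bool

/-- The orders of the cyclic factors, the two ends being `i₀, i₁` with neighbours `j₀, j₁`. -/
def chainOrder (j : Bool → Fin k) : ChainIndex n → ℕ
  | .inl p => neighborSize n p.1
  | .inr e => n (j e) * neighborSize n (j e)

/-- Homomorphisms from the factors indexed by `ChainIndex` to a product of three factors. -/
def piChainOrderEquiv (j : Bool → Fin k) :
    ((p : ChainIndex n) → ZMod (chainOrder n j p)) ≃+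
      (((i : Fin k) → Fin (n i - 2) → ZMod (neighborSize n i)) ×
        ZMod (n (j false) * neighborSize n (j false)) ×
        ZMod (n (j true) * neighborSize n (j true))) where
  toFun s := (fun i b => s (.inl ⟨i, b⟩), s (.inr false), s (.inr true))
  invFun t
    | .inl p => t.1 p.1 p.2
    | .inr false => t.2.1
    | .inr true => t.2.2
  left_inv s := by
    funext p
    rcases p with p | _ | _ <;> rfl
  right_inv _ := rfl
  map_add' _ _ := rfl

theorem exists_criticalGroup_chainGraph_equiv (hn : ∀ i, 2 ≤ n i) (i j : Bool → Fin k)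
    (hij : ∀ e, ∀ l : Fin k, ((l : ℕ) + 1 = i e ∨ (i e : ℕ) + 1 = l) ↔ l = j e)
    (hdisj : ∀ e, i e ≠ i (!e) ∧ i e ≠ j (!e) ∧ j e ≠ j (!e)) :
    ∃ 𝒢 : AddCommGrpCat.{0}, Finite 𝒢 ∧
      Nonempty ((chainGraph n).CriticalGroup ≃+
        (((i : Fin k) → Fin (n i - 2) → ZMod (neighborSize n i)) ×
          ZMod (n (j false) * neighborSize n (j false)) ×
          ZMod (n (j true) * neighborSize n (j true)) × 𝒢)) := by
  have hN : ∀ l, 0 < neighborSize n l := by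
    have hk : 2 ≤ k := by
      have h1 := (i true).2
      have h2 := (i false).2
      have h3 := Fin.val_ne_of_ne (hdisj true).1
      simp only [Bool.not_true] at h3
      omega
    exact neighborSize_pos hk n fun l => (by norm_num : 1 ≤ 2).trans (hn l)
  have hne : ∀ e, j e ≠ i e := by
    intro e h
    have := (hij e (j e)).2 rfl
    rw [h] at this
    omega
  -- Vertex 0 of a part is the base point and vertex 1 is reserved for the corrections in the
  -- characters. This makes the family exactly dual, at the cost of one class per part.
  let y : ChainIndex n → (chainGraph n).LaplacianCokernel
    | .inl p => (chainGraph n).vertexClass ⟨p.1, ⟨p.2 + 2, by have := p.2.2; omega⟩⟩ -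
        (chainGraph n).vertexClass ⟨p.1, ⟨0, by linarith [hn p.1]⟩⟩
    | .inr e => (chainGraph n).vertexClass ⟨j e, ⟨0, by linarith [hn (j e)]⟩⟩ -
        (chainGraph n).vertexClass ⟨i e, ⟨0, by linarith [hn (i e)]⟩⟩
  have hy : ∀ p, chainOrder n j p • y p = 0 := by
    rintro (p | e)
    · change neighborSize n p.1 • (_ - _) = _
      rw [smul_sub, neighborSize_nsmul_vertexClass, sub_self]
    · exact nsmul_endClass_eq_zero n _ _ (hij e) _ _
  have hpos : ∀ p, 0 < chainOrder n j p := by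
    rintro (p | e)
    · exact hN p.1
    · exact Nat.mul_pos (by linarith [hn (j e)]) (hN _)
  let x : ChainIndex n → (chainGraph n).CriticalGroup := fun p =>
    ⟨y p, isOfFinAddOrder_iff_nsmul_eq_zero.2 ⟨_, hpos p, hy p⟩⟩
  let χl (p : Σ i : Fin k, Fin (n i - 2)) :
      (chainGraph n).LaplacianCokernel →+ ZMod (neighborSize n p.1) :=
    (chainGraph n).cokernelLift (twinCharacter n p.1 p.2)
      (twinCharacter_harmonic n p.1 p.2 (by have := p.2.2; omega))
  let χr (e : Bool) :
      (chainGraph n).LaplacianCokernel →+ ZMod (n (j e) * neighborSize n (j e)) :=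
    (chainGraph n).cokernelLift (endCharacter n (i e) (j e))
      (endCharacter_harmonic n _ _ (hn _) (hn _) (hij e))
  have hχl : ∀ p v, χl p ((chainGraph n).vertexClass v) = twinCharacter n p.1 p.2 v :=
    fun p v => SimpleGraph.cokernelLift_vertexClass _ _ _ v
  have hχr : ∀ e v, χr e ((chainGraph n).vertexClass v) = endCharacter n (i e) (j e) v :=
    fun e v => SimpleGraph.cokernelLift_vertexClass _ _ _ v
  have hll : ∀ p q, χl p (y (.inl q)) = if p = q then 1 else 0 := by
    rintro ⟨l, b⟩ ⟨l', b'⟩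
    change χl _ (_ - _) = _
    rw [map_sub, hχl, hχl]
    by_cases hl : l' = l
    · subst hl
      simp [twinCharacter, Fin.ext_iff, eq_comm]
    · have : l ≠ l' := fun h => hl h.symm
      simp [twinCharacter, hl, this]
  have hlr : ∀ p e, χl p (y (.inr e)) = 0 := by
    intro p e
    change χl _ (_ - _) = _
    rw [map_sub, hχl, hχl]
    simp [twinCharacter]
  have hrl : ∀ e p, χr e (y (.inl p)) = 0 := by
    intro e p
    change χr _ (_ - _) = _
    rw [map_sub, hχr, hχr]
    simp [endCharacter]
  have hrr : ∀ e e', χr e (y (.inr e')) = if e = e' then 1 else 0 := by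
    intro e e'
    change χr _ (_ - _) = _
    rw [map_sub, hχr, hχr]
    by_cases he : e = e'
    · subst he
      simp [endCharacter, hne e]
    · obtain rfl : e' = !e := by cases e <;> cases e' <;> simp_all
      have h1 := hdisj e
      have h2 := hdisj (!e)
      rw [Bool.not_not] at h2
      simp [endCharacter, h1.1.symm, h1.2.2.symm, h2]
  let χ : ∀ p : ChainIndex n, (chainGraph n).LaplacianCokernel →+ ZMod (chainOrder n j p)
    | .inl p => χl p
    | .inr e => χr e
  have hχ : ∀ p q, χ p (y q) = if p = q then 1 else 0 := by
    rintro (p | e) (q | e')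
    · refine (hll p q).trans ?_
      by_cases h : p = q
      · rw [if_pos h, if_pos (congrArg _ h)]; rfl
      · rw [if_neg h, if_neg (mt Sum.inl.inj h)]; rfl
    · exact (hlr p e').trans (if_neg Sum.inl_ne_inr).symm
    · exact (hrl e q).trans (if_neg Sum.inr_ne_inl).symm
    · refine (hrr e e').trans ?_
      by_cases h : e = e'
      · rw [if_pos h, if_pos (congrArg _ h)]; rfl
      · rw [if_neg h, if_neg (mt Sum.inr.inj h)]; rfl
  let ψ p := (χ p).comp (AddCommGroup.torsion (chainGraph n).LaplacianCokernel).subtype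
  obtain ⟨E⟩ := nonempty_equiv_pi_zmod_prod_ker (chainOrder n j) x
    (fun p => Subtype.ext (hy p)) ψ hχ
  refine ⟨AddCommGrpCat.of (AddMonoidHom.pi ψ).ker,
    inferInstanceAs (Finite (AddMonoidHom.pi ψ).ker), ⟨E.trans ?_⟩⟩
  exact ((piChainOrderEquiv n j).prodCongr (AddEquiv.refl _)).trans
    (AddEquiv.prodAssoc.trans ((AddEquiv.refl _).prodCongr AddEquiv.prodAssoc))

end Decomposition

theorem mainTheorem2 (k : ℕ) (hk : 4 ≤ k) :
    ∃ 𝒢 : (Fin k → ℕ) → AddCommGrpCat.{0}, ∀ n : Fin k → ℕ, (∀ i, 1 ≤ n i) →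
      -- the defining property of the critical group
      Nonempty ((chainGraph n).LaplacianCokernel ≃+ ℤ × (chainGraph n).CriticalGroup) ∧
      -- the decomposition
      ((∀ i, 2 ≤ n i) →
        Finite (𝒢 n) ∧
        Nonempty ((chainGraph n).CriticalGroup ≃+
          (((i : Fin k) → Fin (n i - 2) → ZMod (neighborSize n i)) ×
            ZMod (n ⟨1, by omega⟩ * (n ⟨0, by omega⟩ + n ⟨2, by omega⟩)) ×
            ZMod (n ⟨k - 2, by omega⟩ * (n ⟨k - 3, by omega⟩ + n ⟨k - 1, by omega⟩)) ×
            𝒢 n))) ∧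
      -- every cofactor of the Laplacian, for every ordering of the vertices
      (∀ (m : ℕ) (e : Fin (m + 1) ≃ Σ i : Fin k, Fin (n i)) (p q : Fin (m + 1)),
        (-1 : ℤ) ^ ((p : ℕ) + (q : ℕ)) *
          ((((chainGraph n).lapMatrix ℤ).submatrix e e).submatrix
            p.succAbove q.succAbove).det = (chainTreeCount n : ℤ)) ∧
      -- the number of spanning trees
      (chainGraph n).numSpanningTrees = chainTreeCount n := by
  have hdec : ∀ n : Fin k → ℕ, (∀ i, 2 ≤ n i) → ∃ 𝒢 : AddCommGrpCat.{0}, Finite 𝒢 ∧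
      Nonempty ((chainGraph n).CriticalGroup ≃+
        (((i : Fin k) → Fin (n i - 2) → ZMod (neighborSize n i)) ×
          ZMod (n ⟨1, by omega⟩ * (n ⟨0, by omega⟩ + n ⟨2, by omega⟩)) ×
          ZMod (n ⟨k - 2, by omega⟩ * (n ⟨k - 3, by omega⟩ + n ⟨k - 1, by omega⟩)) × 𝒢)) := by
    intro n hn
    have h := exists_criticalGroup_chainGraph_equiv n hn
      (fun e => if e then ⟨k - 1, by omega⟩ else ⟨0, by omega⟩)
      (fun e => if e then ⟨k - 2, by omega⟩ else ⟨1, by omega⟩)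
      (by
        rintro (_ | _) l
        · simp [Fin.ext_iff]; omega
        · simp [Fin.ext_iff]; omega)
      -- The two ends and their two neighbours are four distinct parts because `k ≥ 4`.
      (by
        rintro (_ | _)
        · simp [Fin.ext_iff]; omega
        · simp [Fin.ext_iff]; omega)
    have h1 : neighborSize n ⟨1, by omega⟩ = n ⟨0, by omega⟩ + n ⟨2, by omega⟩ := by
      rw [neighborSize, dif_pos (by simp), dif_pos (by simp only; omega)]
      rfl
    have h2 : neighborSize n ⟨k - 2, by omega⟩ = n ⟨k - 3, by omega⟩ + n ⟨k - 1, by omega⟩ := by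
      rw [neighborSize, dif_pos (by simp only; omega), dif_pos (by simp only; omega)]
      congr 2
      exact Fin.ext (by simp only; omega)
    rw [← h1, ← h2]
    exact h
  -- The choice depends on `n` alone; its value is irrelevant when some part has fewer than two
  -- vertices.
  choose! 𝒢 h𝒢 using hdec
  refine ⟨𝒢, fun n hn => ?_⟩
  have hconn := connected_chainGraph (by omega) n hn
  refine ⟨hconn.nonempty_laplacianCokernel_equiv, h𝒢 n, fun m e p q => ?_,
    numSpanningTrees_chainGraph (by omega) n hn⟩
  rw [← Matrix.adjugate_fin_succ_eq_det_submatrix,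
    Matrix.adjugate_submatrix_equiv_self, Matrix.submatrix_apply, hconn.adjugate_lapMatrix,
    numSpanningTrees_chainGraph (by omega) n hn]
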